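/- Let $K$ be a field and let $A=K[[X_1,X_2,\dots]]$, where this notation may stand either for the union $\bigcup_{n\ge 0}K[[X_1,\dots,X_n]]$ or for the ring of all formal power series in the countably many variables $X_1,X_2,\dots$ over $K$. Then $A$ is a local ring; let $m$ be its maximal ideal (for the union, $m=(X_1,X_2,\dots)$). Let $(A/m)^{(\infty)}$ be a direct sum of infinitely many copies of $A/m$, indexed by an arbitrary infinite set, and let $R=A\ltimes (A/m)^{(\infty)}$ be the trivial ring extension, that is, the additive group $A\times (A/m)^{(\infty)}$ with multiplication $(a,e)(a',e')=(aa',ae'+a'e)$. An $R$-module $M$ is called strongly Gorenstein projective if there are a projective $R$-module $P$ and an endomorphism $f$ of $P$ with $M\cong\operatorname{Im} f$ such that the complex $\cdots\xrightarrow{f}P\xrightarrow{f}P\xrightarrow{f}P\xrightarrow{f}\cdots$ is exact and remains exact under $\operatorname{Hom}_R(-,Q)$ for every projective $R$-module $Q$. Then: 1. the weak global dimension of $R$ (the supremum of the flat dimensions of all $R$-modules) is infinite; 2. every finitely generated strongly Gorenstein projective $R$-module is projective; 3. no nonzero proper finitely generated ideal of $R$ is strongly Gorenstein projective. -/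

import Mathlib

universe u v

/-- The ring `⋃ₙ K[[X₀, …, Xₙ₋₁]]` of formal power series over `K` in the variables `X₀, X₁, …`,
each of which involves only finitely many variables, as a `K`-subalgebra of the ring
`MvPowerSeries ℕ K` of all formal power series in these variables. -/
def powerSeriesUnion (K : Type u) [Field K] : Subalgebra K (MvPowerSeries ℕ K) where
  carrier := {f | ∃ n : ℕ, ∀ d : ℕ →₀ ℕ, MvPowerSeries.coeff d f ≠ 0 → ∀ i ∈ d.support, i < n}
  mul_mem' := by
    classical
    rintro f g ⟨n, hn⟩ ⟨k, hk⟩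
    refine ⟨max n k, fun d hd i hi => ?_⟩
    rw [MvPowerSeries.coeff_mul] at hd
    obtain ⟨p, hp, hne⟩ := Finset.exists_ne_zero_of_sum_ne_zero hd
    rw [Finset.HasAntidiagonal.mem_antidiagonal] at hp
    rw [← hp] at hi
    rcases Finset.mem_union.mp (Finsupp.support_add hi) with h | h
    · exact lt_max_of_lt_left (hn p.1 (left_ne_zero_of_mul hne) i h)
    · exact lt_max_of_lt_right (hk p.2 (right_ne_zero_of_mul hne) i h)
  add_mem' := by
    rintro f g ⟨n, hn⟩ ⟨k, hk⟩
    refine ⟨max n k, fun d hd i hi => ?_⟩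
    by_cases hf : MvPowerSeries.coeff d f = 0
    · have hg : MvPowerSeries.coeff d g ≠ 0 := by
        intro hg
        exact hd (by rw [map_add, hf, hg, add_zero])
      exact lt_max_of_lt_right (hk d hg i hi)
    · exact lt_max_of_lt_left (hn d hf i hi)
  algebraMap_mem' := by
    classical
    intro r
    refine ⟨0, fun d hd i hi => ?_⟩
    rw [MvPowerSeries.algebraMap_apply, MvPowerSeries.coeff_C] at hd
    have h0 : d = 0 := by
      by_contra h
      exact hd (if_neg h)
    simp [h0] at hi

/-- The trivial ring extension `A ∝ (A/m)^(ι)` of `A` by a direct sum of copies of `A/m` indexed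
by `ι`: the additive group `A × (A/m)^(ι)` with `(a, e)(a', e') = (aa', ae' + a'e)`. -/
def ResidueExtension (A : Type u) [CommRing A] (m : Ideal A) (ι : Type v) : Type (max u v) :=
  TrivSqZeroExt A (ι →₀ A ⧸ m)

/-- The usual commutative ring structure of the trivial extension. -/
noncomputable instance ResidueExtension.instCommRing (A : Type u) [CommRing A] (m : Ideal A)
    (ι : Type v) : CommRing (ResidueExtension A m ι) :=
  inferInstanceAs (CommRing (TrivSqZeroExt A (ι →₀ A ⧸ m)))

/-- `M` is strongly Gorenstein projective: there is a projective module `P` with an endomorphism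
`f` such that `⋯ ⟶ P ⟶ P ⟶ P ⟶ ⋯`, with every map equal to `f`, is a complete projective
resolution (it is exact, and stays exact under `Hom(-, Q)` for each projective module `Q`), and
`M` is isomorphic to the image of `f`. -/
def IsStronglyGorensteinProjective (R : Type u) [CommRing R]
    (M : Type u) [AddCommGroup M] [Module R M] : Prop :=
  ∃ (P : Type u) (_ : AddCommGroup P) (_ : Module R P) (f : P →ₗ[R] P),
    Module.Projective R P ∧
    Function.Exact f f ∧
    (∀ (Q : Type u) [AddCommGroup Q] [Module R Q], Module.Projective R Q →
      Function.Exact (f.lcomp R Q) (f.lcomp R Q)) ∧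
    Nonempty (M ≃ₗ[R] LinearMap.range f)

/-- `M` has a flat resolution `0 → Fₙ → ⋯ → F₀ → M → 0` of length `n`. -/
def HasFlatResolution (R : Type u) [CommRing R] :
    ℕ → ∀ (M : Type u) [AddCommGroup M] [Module R M], Prop
  | 0, M, _, _ => Module.Flat R M
  | n + 1, M, _, _ =>
    ∃ (F : Type u) (_ : AddCommGroup F) (_ : Module R F) (p : F →ₗ[R] M),
      Module.Flat R F ∧ Function.Surjective p ∧ HasFlatResolution R n (LinearMap.ker p)

/-- The flat dimension of a module: the least length of a flat resolution, `⊤` if there is none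
of finite length. -/
noncomputable def flatDimension (R : Type u) [CommRing R]
    (M : Type u) [AddCommGroup M] [Module R M] : ℕ∞ :=
  ⨅ (n : ℕ) (_ : HasFlatResolution R n M), (n : ℕ∞)

/-- The weak global dimension of a ring: the supremum of the flat dimensions of its modules. -/
noncomputable def weakGlobalDimension (R : Type u) [CommRing R] : ℕ∞ :=
  ⨆ M : ModuleCat.{u} R, flatDimension R M

/-! Let `𝔫` be the maximal ideal of the local ring `R`, `k = R/𝔫`, and let `Z = 0 × (A/m)^(ι)`,
called `socle` below. The three assertions on `R` rest on three facts: `Z` is not finitely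
generated, `Z𝔫 = 0` and `Z ∩ 𝔫² = 0`.

Weak dimension: a nonzero `z ∈ Z` is killed by `𝔫` and lies outside `𝔫²`, so it spans a copy of `k`
that splits off `𝔫`, the first syzygy of `k`. Passing to syzygies would shorten any finite flat
resolution of `k` until `k` itself were flat, hence free, which `z` forbids
(`not_hasFlatResolution_residueField`).

Strongly Gorenstein projectives: if `ker f = range f` is finitely generated, then `ker f ∩ 𝔫P ⊆ 𝔫
ker f` (`ker_inf_maximalIdeal_smul_le`), since a failure would embed `Z` in the finite-dimensional
space `ker f / 𝔫 ker f`. Thus `ker f → P` is injective modulo `𝔫`, which makes `P / ker f ≅ M` free.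

Ideals: a proper ideal is killed by `Z ≠ 0`, so it cannot be free unless it is zero. -/

open IsLocalRing TensorProduct

/-! ### Flat dimension and syzygies -/

section FlatDimension

variable {R : Type u} [CommRing R]

theorem Module.exists_free_surjective (M : Type u) [AddCommGroup M] [Module R M] :
    ∃ (P : Type u) (_ : AddCommGroup P) (_ : Module R P) (q : P →ₗ[R] M),
      Module.Free R P ∧ Function.Surjective q :=
  ⟨M →₀ R, inferInstance, inferInstance, Finsupp.linearCombination R id,
    inferInstance, Finsupp.linearCombination_id_surjective R M⟩

/-- This is the vanishing of `Tor₁(Q, F)` for flat `F`, obtained by a diagram chase along a free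
cover of `Q`. -/
theorem lTensor_injective_of_flat_right {M N F : Type u} [AddCommGroup M] [AddCommGroup N]
    [AddCommGroup F] [Module R M] [Module R N] [Module R F] [Module.Flat R F]
    {g : M →ₗ[R] N} {p : N →ₗ[R] F} (hg : Function.Injective g) (hp : Function.Surjective p)
    (h : Function.Exact g p) (Q : Type u) [AddCommGroup Q] [Module R Q] :
    Function.Injective (g.lTensor Q) := by
  obtain ⟨P, _, _, q, hP, hq⟩ := Module.exists_free_surjective (R := R) Q
  have h1 : Function.Injective ((LinearMap.ker q).subtype.rTensor F) :=
    Module.Flat.rTensor_preserves_injective_linearMap _ (LinearMap.ker q).subtype_injective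
  exact lTensor_injective_of_exact_of_exact_of_rTensor_injective
    (f₁ := (LinearMap.ker q).subtype) (LinearMap.exact_subtype_ker_map q) hq h hp h1
    (Module.Flat.lTensor_preserves_injective_linearMap _ hg)

theorem Module.Flat.of_exact {M N F : Type u} [AddCommGroup M] [AddCommGroup N]
    [AddCommGroup F] [Module R M] [Module R N] [Module R F] [Module.Flat R N] [Module.Flat R F]
    {g : M →ₗ[R] N} {p : N →ₗ[R] F} (hg : Function.Injective g) (hp : Function.Surjective p)
    (h : Function.Exact g p) : Module.Flat R M := by
  refine Module.Flat.iff_rTensor_preserves_injective_linearMap'.mpr fun X Y _ _ _ _ f hf ↦ ?_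
  have h1 : Function.Injective (g.lTensor Y ∘ₗ f.rTensor M) := by
    rw [LinearMap.lTensor_comp_rTensor, ← LinearMap.rTensor_comp_lTensor]
    exact (Module.Flat.rTensor_preserves_injective_linearMap f hf).comp
      (lTensor_injective_of_flat_right hg hp h X)
  exact Function.Injective.of_comp h1

theorem Module.Flat.prod (M N : Type u) [AddCommGroup M] [AddCommGroup N]
    [Module R M] [Module R N] [Module.Flat R M] [Module.Flat R N] : Module.Flat R (M × N) := by
  refine Module.Flat.iff_rTensor_preserves_injective_linearMap'.mpr fun (X Y : Type u) _ _ _ _ f hf ↦ ?_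
  have key : ∀ (L : Type u) [AddCommGroup L] [Module R L] [Module.Flat R L] (g : M × N →ₗ[R] L)
      (z : TensorProduct R X (M × N)), f.rTensor (M × N) z = 0 → g.lTensor X z = 0 := by
    intro L _ _ _ g z hz
    apply Module.Flat.rTensor_preserves_injective_linearMap (M := L) f hf
    rw [map_zero, ← LinearMap.comp_apply, LinearMap.rTensor_comp_lTensor,
      ← LinearMap.lTensor_comp_rTensor, LinearMap.comp_apply, hz, map_zero]
  rw [injective_iff_map_eq_zero]
  intro z hz
  have hid : LinearMap.id = LinearMap.inl R M N ∘ₗ LinearMap.fst R M N +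
      LinearMap.inr R M N ∘ₗ LinearMap.snd R M N := by
    ext <;> simp
  have : (LinearMap.id : M × N →ₗ[R] M × N).lTensor X z = 0 := by
    rw [hid, LinearMap.lTensor_add, LinearMap.lTensor_comp, LinearMap.lTensor_comp,
      LinearMap.add_apply, LinearMap.comp_apply, LinearMap.comp_apply, key M _ z hz,
      key N _ z hz, map_zero, map_zero, add_zero]
  simpa using this

theorem HasFlatResolution.of_linearEquiv {n : ℕ} {M N : Type u} [AddCommGroup M] [AddCommGroup N]
    [Module R M] [Module R N] (h : HasFlatResolution R n M) (e : M ≃ₗ[R] N) :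
    HasFlatResolution R n N := by
  cases n with
  | zero =>
    have : Module.Flat R M := h
    exact Module.Flat.of_linearEquiv e.symm
  | succ n =>
    obtain ⟨F, _, _, p, hF, hp, hk⟩ := h
    refine ⟨F, _, _, e.toLinearMap ∘ₗ p, hF, e.surjective.comp hp, ?_⟩
    rwa [LinearEquiv.ker_comp]

theorem HasFlatResolution.of_exact {n : ℕ} {K F M : Type u} [AddCommGroup K] [AddCommGroup F]
    [AddCommGroup M] [Module R K] [Module R F] [Module R M] [Module.Flat R F]
    {i : K →ₗ[R] F} {p : F →ₗ[R] M} (hi : Function.Injective i) (hp : Function.Surjective p)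
    (h : Function.Exact i p) (hK : HasFlatResolution R n K) : HasFlatResolution R (n + 1) M :=
  ⟨F, _, _, p, ‹_›, hp, hK.of_linearEquiv
    (LinearEquiv.ofInjective i hi ≪≫ₗ LinearEquiv.ofEq _ _ h.linearMap_ker_eq.symm)⟩

/-- In positive length, a flat cover `q` of `X` restricts to a cover of `ker p` by `ker (p ∘ q)`,
which is flat, and the kernel of this restriction is still `ker q`. -/
theorem HasFlatResolution.ker_of_flat {n : ℕ} {X F : Type u} [AddCommGroup X] [AddCommGroup F]
    [Module R X] [Module R F] [Module.Flat R F] (h : HasFlatResolution R n X) (p : X →ₗ[R] F)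
    (hp : Function.Surjective p) : HasFlatResolution R n (LinearMap.ker p) := by
  cases n with
  | zero =>
    have : Module.Flat R X := h
    exact Module.Flat.of_exact (LinearMap.ker p).subtype_injective hp
      (LinearMap.exact_subtype_ker_map p)
  | succ n =>
    obtain ⟨G, _, _, q, hG, hq, hk⟩ := h
    have hflat : Module.Flat R (LinearMap.ker (p ∘ₗ q)) :=
      Module.Flat.of_exact (LinearMap.ker (p ∘ₗ q)).subtype_injective (hp.comp hq)
        (LinearMap.exact_subtype_ker_map (p ∘ₗ q))
    refine HasFlatResolution.of_exact (F := LinearMap.ker (p ∘ₗ q))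
      (i := Submodule.inclusion (LinearMap.ker_le_ker_comp q p))
      (p := q.restrict (p := LinearMap.ker (p ∘ₗ q)) (q := LinearMap.ker p) fun x hx ↦ hx)
      (Submodule.inclusion_injective _) ?_ ?_ hk
    · rintro ⟨x, hx⟩
      obtain ⟨y, rfl⟩ := hq x
      exact ⟨⟨y, hx⟩, rfl⟩
    · rintro ⟨y, hy⟩
      constructor
      · intro h
        exact ⟨⟨y, congrArg Subtype.val h⟩, rfl⟩
      · rintro ⟨x, hx⟩
        have : (x : G) = y := congrArg Subtype.val hx
        exact Subtype.ext (this ▸ x.2)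

theorem HasFlatResolution.prod_flat {n : ℕ} {X P : Type u} [AddCommGroup X] [AddCommGroup P]
    [Module R X] [Module R P] [Module.Flat R P] (h : HasFlatResolution R n X) :
    HasFlatResolution R n (X × P) := by
  cases n with
  | zero =>
    have : Module.Flat R X := h
    exact Module.Flat.prod X P
  | succ n =>
    obtain ⟨F, _, _, p, hF, hp, hk⟩ := h
    have := Module.Flat.prod F P (R := R)
    refine HasFlatResolution.of_exact (F := F × P)
      (i := LinearMap.inl R F P ∘ₗ (LinearMap.ker p).subtype) (p := p.prodMap LinearMap.id)
      (LinearMap.inl_injective.comp Subtype.val_injective)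
      (Function.Surjective.prodMap hp Function.surjective_id) ?_ hk
    rintro ⟨x, y⟩
    simp [Prod.ext_iff, eq_comm]

/-- Syzygies with respect to projective covers compute flat dimension. -/
theorem HasFlatResolution.ker_of_projective {n : ℕ} {M P : Type u} [AddCommGroup M]
    [AddCommGroup P] [Module R M] [Module R P] [Module.Projective R P]
    (h : HasFlatResolution R (n + 1) M) (q : P →ₗ[R] M) (hq : Function.Surjective q) :
    HasFlatResolution R n (LinearMap.ker q) := by
  obtain ⟨F, _, _, p, hF, hp, hk⟩ := h
  obtain ⟨s, hs⟩ := Module.projective_lifting_property p q hp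
  have hs' : ∀ x, p (s x) = q x := fun x ↦ LinearMap.congr_fun hs x
  have h1 : HasFlatResolution R n (LinearMap.ker p × P) := hk.prod_flat
  -- The map `t` is onto because `P` already covers `M`. Its kernel is a copy of `ker q` through
  -- `(a, x) ↦ x`, as `a = -s x` is forced.
  let t : LinearMap.ker p × P →ₗ[R] F := (LinearMap.ker p).subtype.coprod s
  have ht : ∀ x, t x = x.1 + s x.2 := fun x ↦ rfl
  have htsurj : Function.Surjective t := by
    intro y
    obtain ⟨x, hx⟩ := hq (p y)
    exact ⟨(⟨y - s x, by rw [LinearMap.mem_ker, map_sub, hs', hx, sub_self]⟩, x), by simp [ht]⟩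
  let e : LinearMap.ker t →ₗ[R] LinearMap.ker q :=
    (LinearMap.snd R _ _).restrict fun x hx ↦ by
      rw [LinearMap.mem_ker, LinearMap.snd_apply, ← hs']
      have h2 := congrArg p ((ht x).symm.trans hx)
      rwa [map_add, map_zero, LinearMap.mem_ker.mp x.1.2, zero_add] at h2
  refine (h1.ker_of_flat t htsurj).of_linearEquiv (LinearEquiv.ofBijective e ⟨?_, ?_⟩)
  · rw [injective_iff_map_eq_zero]
    rintro ⟨⟨a, x⟩, hx⟩ h0
    have hx0 : x = 0 := congrArg Subtype.val h0
    subst hx0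
    have ha : (a : F) + s 0 = 0 := hx
    rw [map_zero, add_zero] at ha
    have ha' : a = 0 := Subtype.ext ha
    subst ha'
    rfl
  · rintro ⟨x, hx⟩
    exact ⟨⟨(⟨- s x, by rw [LinearMap.mem_ker, map_neg, hs', hx, neg_zero]⟩, x), by
      rw [LinearMap.mem_ker, ht, neg_add_cancel]⟩, rfl⟩

theorem HasFlatResolution.of_retract {n : ℕ} {X Y : Type u} [AddCommGroup X] [AddCommGroup Y]
    [Module R X] [Module R Y] (h : HasFlatResolution R n Y) (i : X →ₗ[R] Y) (r : Y →ₗ[R] X)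
    (hri : r ∘ₗ i = LinearMap.id) : HasFlatResolution R n X := by
  induction n generalizing X Y with
  | zero =>
    have : Module.Flat R Y := h
    exact Module.Flat.of_retract i r hri
  | succ n ih =>
    have hri' : ∀ x, r (i x) = x := fun x ↦ LinearMap.congr_fun hri x
    obtain ⟨P, _, _, q, hP, hq⟩ := Module.exists_free_surjective (R := R) X
    obtain ⟨G, _, _, w, hG, hw⟩ := Module.exists_free_surjective (R := R) Y
    -- The map `c` covers `Y = i(X) ⊕ ker r` summand by summand. Hence `r ∘ c` is `q` on the first
    -- factor, and `ker q` is a retract of `ker c`.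
    let c : P × G →ₗ[R] Y := (i ∘ₗ q).coprod (w - i ∘ₗ r ∘ₗ w)
    have hc : ∀ x, c x = i (q x.1) + (w x.2 - i (r (w x.2))) := fun x ↦ rfl
    have hcsurj : Function.Surjective c := by
      intro y
      obtain ⟨a, ha⟩ := hq (r y)
      obtain ⟨b, hb⟩ := hw y
      exact ⟨(a, b), by rw [hc, ha, hb, add_sub_cancel]⟩
    have hk := h.ker_of_projective c hcsurj
    let i' : LinearMap.ker q →ₗ[R] LinearMap.ker c :=
      (LinearMap.inl R _ _).restrict fun x hx ↦ by
        rw [LinearMap.mem_ker, hc]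
        simp [LinearMap.mem_ker.mp hx]
    let r' : LinearMap.ker c →ₗ[R] LinearMap.ker q :=
      (LinearMap.fst R _ _).restrict fun x hx ↦ by
        have h2 := congrArg r ((hc x).symm.trans hx)
        rwa [map_add, map_sub, hri', hri', sub_self, add_zero, map_zero] at h2
    have hri'' : r' ∘ₗ i' = LinearMap.id := LinearMap.ext fun x ↦ rfl
    exact HasFlatResolution.of_exact (LinearMap.ker q).subtype_injective hq
      (LinearMap.exact_subtype_ker_map q) (ih hk i' r' hri'')

theorem exists_linearMap_residueField_eq_one [IsLocalRing R] {W : Type u} [AddCommGroup W]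
    [Module R W] (hW : ∀ x ∈ maximalIdeal R, ∀ w : W, x • w = 0) {v : W} (hv : v ≠ 0) :
    ∃ φ : W →ₗ[R] R ⧸ maximalIdeal R, φ v = 1 := by
  have hT : Module.IsTorsionBySet R W (maximalIdeal R) := fun w x ↦ hW x x.2 w
  let := hT.module
  have : IsScalarTower R (R ⧸ maximalIdeal R) W := hT.isScalarTower
  let : Field (R ⧸ maximalIdeal R) := Ideal.Quotient.field _
  obtain ⟨φ, hφ⟩ := Module.Projective.exists_dual_ne_zero (R ⧸ maximalIdeal R) hv
  exact ⟨((φ v)⁻¹ • φ).restrictScalars R, inv_mul_cancel₀ hφ⟩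

/-- If the maximal ideal of a local ring has an element outside of its square that is annihilated
by the maximal ideal, then the residue field is a direct summand of its own first syzygy, so it
has infinite flat dimension. -/
theorem not_hasFlatResolution_residueField [IsLocalRing R] {z : R} (hz : z ∈ maximalIdeal R)
    (hz2 : z ∉ maximalIdeal R ^ 2) (hann : ∀ x ∈ maximalIdeal R, x * z = 0) (n : ℕ) :
    ¬ HasFlatResolution R n (R ⧸ maximalIdeal R) := by
  induction n with
  | zero =>
    intro h
    have : Module.Flat R (R ⧸ maximalIdeal R) := h
    have : Module.Free R (R ⧸ maximalIdeal R) := Module.free_of_flat_of_isLocalRing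
    -- `z` kills the residue field, but only `0` kills a nonzero free module.
    have hz0 : z = 0 := by
      let b := Module.Free.chooseBasis R (R ⧸ maximalIdeal R)
      obtain ⟨j⟩ := b.index_nonempty
      have h1 : z • b j = 0 := by
        obtain ⟨y, hy⟩ := Ideal.Quotient.mk_surjective (b j)
        rw [← hy, Algebra.smul_def, Ideal.Quotient.algebraMap_eq, ← map_mul,
          Ideal.Quotient.eq_zero_iff_mem]
        exact Ideal.mul_mem_right _ _ hz
      have h2 := congrArg (fun v ↦ b.repr v j) h1
      simpa using h2
    exact hz2 (hz0 ▸ zero_mem _)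
  | succ n ih =>
    intro h
    apply ih
    have hk := h.ker_of_projective (maximalIdeal R).mkQ (Submodule.mkQ_surjective _)
    rw [Submodule.ker_mkQ] at hk
    let c : CotangentSpace R := (maximalIdeal R).toCotangent ⟨z, hz⟩
    have hc : c ≠ 0 := by
      rwa [Ne, Ideal.toCotangent_eq_zero]
    obtain ⟨φ, hφ⟩ := exists_linearMap_residueField_eq_one
      (W := CotangentSpace R) (fun (x : R) hx w ↦ by
        rw [← algebraMap_smul (ResidueField R) x w, ResidueField.algebraMap_eq, (residue_eq_zero_iff x).mpr hx, zero_smul]) hc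
    -- `1 ↦ z` is well defined since `𝔫z = 0`; the functional `φ` on `𝔫/𝔫²`, equal to `1` at the
    -- class of `z`, gives a retraction.
    let i : R ⧸ maximalIdeal R →ₗ[R] maximalIdeal R :=
      (maximalIdeal R).liftQ (LinearMap.toSpanSingleton R _ ⟨z, hz⟩) fun x hx ↦
        Subtype.ext (hann x hx)
    refine hk.of_retract i (φ ∘ₗ (maximalIdeal R).toCotangent) ?_
    refine Submodule.linearMap_qext _ (LinearMap.ext_ring ?_)
    have hi : i (Submodule.Quotient.mk 1) = ⟨z, hz⟩ := Subtype.ext (one_mul z)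
    simp only [LinearMap.comp_apply, Submodule.mkQ_apply, hi, LinearMap.id_apply]
    exact hφ

theorem weakGlobalDimension_eq_top [IsLocalRing R] {z : R} (hz : z ∈ maximalIdeal R)
    (hz2 : z ∉ maximalIdeal R ^ 2) (hann : ∀ x ∈ maximalIdeal R, x * z = 0) :
    weakGlobalDimension R = ⊤ := by
  have h : flatDimension R (R ⧸ maximalIdeal R) = ⊤ := by
    simp [flatDimension, not_hasFlatResolution_residueField hz hz2 hann]
  rw [eq_top_iff, ← h]
  exact le_iSup (fun M : ModuleCat.{u} R ↦ flatDimension R M) (ModuleCat.of R (R ⧸ maximalIdeal R))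

end FlatDimension

/-! ### Strongly Gorenstein projective modules over a local ring -/

section StronglyGorensteinProjective

variable {R : Type u} [CommRing R] [IsLocalRing R]

theorem isNoetherian_of_maximalIdeal_smul_eq_zero {W : Type u} [AddCommGroup W] [Module R W]
    [Module.Finite R W] (hW : ∀ x ∈ maximalIdeal R, ∀ w : W, x • w = 0) : IsNoetherian R W := by
  have hT : Module.IsTorsionBySet R W (maximalIdeal R) := fun w x ↦ hW x x.2 w
  let := hT.module
  have : IsScalarTower R (R ⧸ maximalIdeal R) W := hT.isScalarTower
  let : Field (R ⧸ maximalIdeal R) := Ideal.Quotient.field _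
  have : Module.Finite (R ⧸ maximalIdeal R) W := Module.Finite.of_restrictScalars_finite R _ _
  refine ⟨fun U ↦ ?_⟩
  have h1 : (Submodule.span (R ⧸ maximalIdeal R) (U : Set W)).FG := IsNoetherian.noetherian _
  have h2 := h1.restrictScalars (R := R)
  rwa [Submodule.restrictScalars_span R _ Ideal.Quotient.mk_surjective, Submodule.span_eq] at h2

/-- A functional on the `k`-vector space `P/(L + 𝔫P)` equal to `1` at `y` lifts along `R → k`
because `P` is projective. -/
theorem exists_linearMap_notMem_maximalIdeal {P : Type u} [AddCommGroup P] [Module R P]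
    [Module.Projective R P] {L : Submodule R P} {y : P}
    (hy : y ∉ L ⊔ maximalIdeal R • (⊤ : Submodule R P)) :
    ∃ φ : P →ₗ[R] R, (∀ x ∈ L, φ x ∈ maximalIdeal R) ∧ φ y ∉ maximalIdeal R := by
  obtain ⟨ψ, hψ⟩ := exists_linearMap_residueField_eq_one
    (W := P ⧸ (L ⊔ maximalIdeal R • (⊤ : Submodule R P))) (fun (x : R) hx w ↦ by
      obtain ⟨w, rfl⟩ := Submodule.mkQ_surjective _ w
      rw [← map_smul, Submodule.mkQ_apply, Submodule.Quotient.mk_eq_zero]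
      exact Submodule.mem_sup_right (Submodule.smul_mem_smul hx trivial))
    (mt (Submodule.Quotient.mk_eq_zero _).mp hy)
  obtain ⟨φ, hφ⟩ := Module.projective_lifting_property (maximalIdeal R).mkQ
    (ψ ∘ₗ Submodule.mkQ _) (Submodule.mkQ_surjective _)
  have hφ' : ∀ x, (Ideal.Quotient.mk (maximalIdeal R) (φ x)) = ψ (Submodule.Quotient.mk x) :=
    fun x ↦ LinearMap.congr_fun hφ x
  refine ⟨φ, fun x hx ↦ ?_, fun h ↦ ?_⟩
  · rw [← Ideal.Quotient.eq_zero_iff_mem, hφ',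
      (Submodule.Quotient.mk_eq_zero _).mpr (Submodule.mem_sup_left hx), map_zero]
  · rw [← Ideal.Quotient.eq_zero_iff_mem, hφ', hψ] at h
    exact one_ne_zero h

theorem ker_inf_maximalIdeal_smul_le {P : Type u} [AddCommGroup P] [Module R P]
    [Module.Projective R P] {Z : Ideal R} (hZ : ¬ Z.FG) (hZm : Z * maximalIdeal R = ⊥)
    (hZm2 : Z ⊓ maximalIdeal R ^ 2 = ⊥) {f : P →ₗ[R] P} (hf : Function.Exact f f)
    (hfg : (LinearMap.ker f).FG) :
    LinearMap.ker f ⊓ maximalIdeal R • (⊤ : Submodule R P) ≤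
      maximalIdeal R • LinearMap.ker f := by
  rintro x ⟨hx, hxm⟩
  obtain ⟨y, rfl⟩ := (hf x).mp hx
  have hker : ∀ p, f p ∈ LinearMap.ker f := fun p ↦ (hf _).mpr ⟨p, rfl⟩
  -- If `y ∈ ker f + 𝔫P`, then `f y ∈ 𝔫 f(P) ⊆ 𝔫 ker f`.
  suffices hy : y ∈ LinearMap.ker f ⊔ maximalIdeal R • (⊤ : Submodule R P) by
    obtain ⟨a, ha, b, hb, rfl⟩ := Submodule.mem_sup.mp hy
    rw [map_add, LinearMap.mem_ker.mp ha, zero_add]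
    have h1 := Submodule.mem_map_of_mem (f := f) hb
    rw [Submodule.map_smul''] at h1
    refine Submodule.smul_mono le_rfl ?_ h1
    rintro _ ⟨p, -, rfl⟩
    exact hker p
  by_contra hy
  obtain ⟨φ, hφ, hφy⟩ := exists_linearMap_notMem_maximalIdeal hy
  -- Here `f y ∈ 𝔫P` and `Z𝔫 = 0`.
  have hzy : ∀ z ∈ Z, z • y ∈ LinearMap.ker f := by
    intro z hz
    rw [LinearMap.mem_ker, map_smul]
    have h1 : z • f y ∈ Z • maximalIdeal R • (⊤ : Submodule R P) := Submodule.smul_mem_smul hz hxm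
    rw [← Submodule.smul_assoc, smul_eq_mul, hZm, Submodule.bot_smul] at h1
    exact h1
  let S : Submodule R (LinearMap.ker f) := maximalIdeal R • ⊤
  let g : Z →ₗ[R] LinearMap.ker f :=
    ((LinearMap.toSpanSingleton R P y) ∘ₗ Z.subtype).codRestrict _ fun z ↦ hzy z z.2
  have : Module.Finite R (LinearMap.ker f) := Module.Finite.iff_fg.mpr hfg
  have hN : IsNoetherian R (LinearMap.ker f ⧸ S) :=
    isNoetherian_of_maximalIdeal_smul_eq_zero fun (x : R) hx w ↦ by
      obtain ⟨w, rfl⟩ := Submodule.mkQ_surjective _ w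
      rw [← map_smul, Submodule.mkQ_apply, Submodule.Quotient.mk_eq_zero]
      exact Submodule.smul_mem_smul hx trivial
  -- If `z y ∈ 𝔫 ker f`, applying `φ` gives `z φ(y) ∈ 𝔫²` with `φ(y)` a unit, so `z ∈ Z ∩ 𝔫² = 0`.
  have hinj : Function.Injective (S.mkQ ∘ₗ g) := by
    rw [injective_iff_map_eq_zero]
    rintro ⟨z, hz⟩ h
    have h1 : g ⟨z, hz⟩ ∈ S := (Submodule.Quotient.mk_eq_zero _).mp h
    have h2 := Submodule.mem_map_of_mem (f := φ ∘ₗ (LinearMap.ker f).subtype) h1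
    rw [Submodule.map_smul''] at h2
    have h3 : φ (z • y) ∈ maximalIdeal R ^ 2 := by
      rw [pow_two]
      refine Submodule.smul_mono le_rfl ?_ h2
      rintro _ ⟨p, -, rfl⟩
      exact hφ p p.2
    rw [map_smul, smul_eq_mul] at h3
    have h4 : z ∈ maximalIdeal R ^ 2 := by
      rw [mem_maximalIdeal, mem_nonunits_iff, not_not] at hφy
      exact (Ideal.mul_unit_mem_iff_mem _ hφy).mp h3
    have h5 : z ∈ (⊥ : Ideal R) := hZm2 ▸ ⟨hz, h4⟩
    exact Subtype.ext h5
  have hZN : IsNoetherian R Z := isNoetherian_of_injective _ hinj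
  exact hZ (Module.Finite.iff_fg.mp inferInstance)

theorem one_tmul_residueField_eq_zero_iff {P : Type u} [AddCommGroup P] [Module R P] {x : P} :
    TensorProduct.mk R (ResidueField R) P 1 x = 0 ↔
      x ∈ maximalIdeal R • (⊤ : Submodule R P) := by
  rw [← Submodule.Quotient.mk_eq_zero]
  refine ((TensorProduct.quotTensorEquivQuotSMul P (maximalIdeal R)).map_eq_zero_iff).symm.trans ?_
  have : TensorProduct.quotTensorEquivQuotSMul P (maximalIdeal R)
      (Ideal.Quotient.mk (maximalIdeal R) 1 ⊗ₜ[R] x) = Submodule.Quotient.mk x := by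
    rw [TensorProduct.quotTensorEquivQuotSMul_mk_tmul, one_smul]
  exact Eq.congr this rfl

/-- Finitely generated strongly Gorenstein projective modules over a local ring are projective when
the ring has an ideal `Z` which is not finitely generated, is annihilated by the maximal ideal and
meets the square of the maximal ideal trivially. -/
theorem IsStronglyGorensteinProjective.projective {Z : Ideal R} (hZ : ¬ Z.FG)
    (hZm : Z * maximalIdeal R = ⊥) (hZm2 : Z ⊓ maximalIdeal R ^ 2 = ⊥)
    {M : Type u} [AddCommGroup M] [Module R M] [Module.Finite R M]
    (hM : IsStronglyGorensteinProjective R M) : Module.Projective R M := by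
  obtain ⟨P, _, _, f, hP, hf, -, ⟨e⟩⟩ := hM
  have hr : Module.Finite R (LinearMap.range f) := Module.Finite.equiv e
  -- By exactness `ker f = range f ≅ M`, so `P` is an extension of two finitely generated modules.
  have hk : Module.Finite R (LinearMap.ker f) := by
    rwa [hf.linearMap_ker_eq]
  have hq : Module.Finite R (P ⧸ LinearMap.ker f) :=
    Module.Finite.equiv f.quotKerEquivRange.symm
  have hPfin : Module.Finite R P := Module.Finite.of_submodule_quotient (LinearMap.ker f)
  have hPfree : Module.Free R P := Module.free_of_flat_of_isLocalRing
  have hle := ker_inf_maximalIdeal_smul_le hZ hZm hZm2 hf (Module.Finite.iff_fg.mp hk)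
  -- Every tensor here has the form `1 ⊗ x`, so injectivity amounts to `ker f ∩ 𝔫P ⊆ 𝔫 ker f`.
  have hinj : Function.Injective ((LinearMap.ker f).subtype.lTensor (ResidueField R)) := by
    rw [injective_iff_map_eq_zero]
    intro t ht
    obtain ⟨x, rfl⟩ := TensorProduct.mk_surjective R (LinearMap.ker f) (ResidueField R)
      Ideal.Quotient.mk_surjective t
    have hx : (x : P) ∈ maximalIdeal R • (⊤ : Submodule R P) := by
      rw [← one_tmul_residueField_eq_zero_iff]
      exact ht
    have hx' : x ∈ maximalIdeal R • (⊤ : Submodule R (LinearMap.ker f)) := by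
      have h1 := hle ⟨x.2, hx⟩
      have h2 : maximalIdeal R • LinearMap.ker f =
          (maximalIdeal R • (⊤ : Submodule R (LinearMap.ker f))).map (LinearMap.ker f).subtype := by
        rw [Submodule.map_smul'', Submodule.map_subtype_top]
      rw [h2] at h1
      obtain ⟨x', hx', h2⟩ := h1
      rwa [← Subtype.ext h2]
    exact one_tmul_residueField_eq_zero_iff.mpr hx'
  have hfree : Module.Free R (P ⧸ LinearMap.ker f) :=
    Module.free_of_lTensor_residueField_injective (LinearMap.ker f).subtype
      (LinearMap.ker f).mkQ (Submodule.mkQ_surjective _) (LinearMap.exact_subtype_mkQ _) hinj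
  have : Module.Projective R (P ⧸ LinearMap.ker f) := inferInstance
  exact Module.Projective.of_equiv (f.quotKerEquivRange ≪≫ₗ e.symm)

theorem Ideal.not_isStronglyGorensteinProjective {Z : Ideal R} (hZ : ¬ Z.FG)
    (hZm : Z * maximalIdeal R = ⊥) (hZm2 : Z ⊓ maximalIdeal R ^ 2 = ⊥) {I : Ideal R} (hI : I.FG)
    (hbot : I ≠ ⊥) (htop : I ≠ ⊤) : ¬ IsStronglyGorensteinProjective R I := by
  intro h
  have hfin : Module.Finite R I := Module.Finite.iff_fg.mpr hI
  have hproj : Module.Projective R I := h.projective hZ hZm hZm2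
  have hfree : Module.Free R I := Module.free_of_flat_of_isLocalRing
  have : Nontrivial I := Submodule.nontrivial_iff_ne_bot.mpr hbot
  let b := Module.Free.chooseBasis R I
  obtain ⟨j⟩ := b.index_nonempty
  apply hZ
  -- A basis vector of `I` lies in `𝔫`, so it is killed by `Z`.
  suffices Z = ⊥ by rw [this]; exact Submodule.fg_bot
  rw [eq_bot_iff]
  intro z hz
  have h1 : z • b j = 0 := by
    refine Subtype.ext ?_
    have h2 : z * (b j : R) ∈ Z * maximalIdeal R :=
      Ideal.mul_mem_mul hz (IsLocalRing.le_maximalIdeal htop (b j).2)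
    rwa [hZm] at h2
  have h2 := congrArg (fun v ↦ b.repr v j) h1
  simpa using h2

end StronglyGorensteinProjective

/-! ### Power series rings in countably many variables -/

section PowerSeries

variable {K : Type u} [Field K]

/-- The recursion for the coefficients of `f⁻¹` introduces no variable absent from `f`. -/
theorem inv_mem_powerSeriesUnion {f : MvPowerSeries ℕ K} (hf : f ∈ powerSeriesUnion K) :
    f⁻¹ ∈ powerSeriesUnion K := by
  classical
  obtain ⟨n, hn⟩ := hf
  refine ⟨n, fun d ↦ ?_⟩
  induction d using WellFoundedLT.induction with
  | ind d ih =>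
    intro hd i hi
    rw [MvPowerSeries.coeff_inv] at hd
    split_ifs at hd with h0
    · simp [h0] at hi
    · obtain ⟨p, hp, hne⟩ := Finset.exists_ne_zero_of_sum_ne_zero (right_ne_zero_of_mul hd)
      rw [Finset.HasAntidiagonal.mem_antidiagonal] at hp
      split_ifs at hne with hlt
      · rw [← hp] at hi
        rcases Finset.mem_union.mp (Finsupp.support_add hi) with h | h
        · exact hn p.1 (left_ne_zero_of_mul hne) i h
        · exact ih p.2 hlt (right_ne_zero_of_mul hne) i h
      · exact absurd rfl hne

/-- A local homomorphism to the field `K` makes `A` local, with its kernel as the maximal ideal. -/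
theorem isLocalHom_constantCoeff_comp_val {A : Subalgebra K (MvPowerSeries ℕ K)}
    (hA : ∀ f ∈ A, f⁻¹ ∈ A) :
    IsLocalHom ((MvPowerSeries.constantCoeff (σ := ℕ) (R := K)).comp A.val.toRingHom) := by
  refine ⟨fun x hx ↦ ?_⟩
  have h0 : MvPowerSeries.constantCoeff (x : MvPowerSeries ℕ K) ≠ 0 := hx.ne_zero
  exact IsUnit.of_mul_eq_one (⟨_, hA x x.2⟩ : A) (Subtype.ext (MvPowerSeries.mul_inv_cancel _ h0))

theorem mem_span_X_of_constantCoeff_eq_zero {n : ℕ} (f : powerSeriesUnion K)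
    (hn : ∀ d : ℕ →₀ ℕ, MvPowerSeries.coeff d (f : MvPowerSeries ℕ K) ≠ 0 → ∀ i ∈ d.support, i < n)
    (h0 : MvPowerSeries.constantCoeff (f : MvPowerSeries ℕ K) = 0) :
    f ∈ Ideal.span {x : powerSeriesUnion K |
      ∃ i : ℕ, (x : MvPowerSeries ℕ K) = MvPowerSeries.X i} := by
  classical
  induction n generalizing f with
  | zero =>
    suffices f = 0 by rw [this]; exact zero_mem _
    ext d
    by_contra h
    have hd : d = 0 := by
      rw [← Finsupp.support_eq_empty]
      exact Finset.eq_empty_of_forall_notMem fun i hi ↦ absurd (hn d h i hi) (Nat.not_lt_zero i)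
    rw [hd] at h
    exact h h0
  | succ n ih =>
    -- Split `f = X n * g + h`, where `h` collects the terms free of `X n`; induction applies to
    -- `h`.
    let g : MvPowerSeries ℕ K := fun e ↦ MvPowerSeries.coeff (e + Finsupp.single n 1) f.1
    have hg : ∀ e, MvPowerSeries.coeff e g = MvPowerSeries.coeff (e + Finsupp.single n 1) f.1 :=
      fun e ↦ rfl
    let h : MvPowerSeries ℕ K := fun e ↦ if e n = 0 then MvPowerSeries.coeff e f.1 else 0
    have hh : ∀ e, MvPowerSeries.coeff e h = if e n = 0 then MvPowerSeries.coeff e f.1 else 0 :=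
      fun e ↦ rfl
    have hX : ∀ d : ℕ →₀ ℕ, MvPowerSeries.coeff d (MvPowerSeries.X n : MvPowerSeries ℕ K) ≠ 0 →
        ∀ i ∈ d.support, i < n + 1 := by
      intro d hd i hi
      rw [MvPowerSeries.coeff_X] at hd
      have hd' : d = Finsupp.single n 1 := by
        by_contra h
        exact hd (if_neg h)
      rw [hd'] at hi
      have := Finset.mem_singleton.mp (Finsupp.support_single_subset hi)
      omega
    have hgn : ∀ d : ℕ →₀ ℕ, MvPowerSeries.coeff d g ≠ 0 → ∀ i ∈ d.support, i < n + 1 := by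
      intro d hd i hi
      refine hn _ hd i ?_
      rw [Finsupp.mem_support_iff] at hi ⊢
      rw [Finsupp.add_apply]
      omega
    have hhn : ∀ d : ℕ →₀ ℕ, MvPowerSeries.coeff d h ≠ 0 → ∀ i ∈ d.support, i < n := by
      intro d hd i hi
      rw [hh] at hd
      split_ifs at hd with hdn
      · have h1 := hn d hd i hi
        have h2 : i ≠ n := by
          rintro rfl
          exact Finsupp.mem_support_iff.mp hi hdn
        omega
      · exact absurd rfl hd
    have hdecomp : f = (⟨_, _, hX⟩ : powerSeriesUnion K) * ⟨g, _, hgn⟩ + ⟨h, _, hhn⟩ := by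
      ext d
      change MvPowerSeries.coeff d f.1 = MvPowerSeries.coeff d (MvPowerSeries.X n * g + h)
      rw [map_add, MvPowerSeries.X_def, MvPowerSeries.coeff_monomial_mul, hh, one_mul, hg]
      by_cases hdn : d n = 0
      · rw [if_neg, if_pos hdn, zero_add]
        rw [Finsupp.single_le_iff]
        omega
      · have hle : Finsupp.single n 1 ≤ d := by
          rw [Finsupp.single_le_iff]
          omega
        rw [if_pos hle, if_neg hdn, add_zero, tsub_add_cancel_of_le hle]
    rw [hdecomp]
    refine add_mem (Ideal.mul_mem_right _ _ (Ideal.subset_span ⟨n, rfl⟩)) (ih _ hhn ?_)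
    exact h0

theorem span_X_eq_ker_constantCoeff :
    Ideal.span {x : powerSeriesUnion K | ∃ i : ℕ, (x : MvPowerSeries ℕ K) = MvPowerSeries.X i} =
      RingHom.ker ((MvPowerSeries.constantCoeff (σ := ℕ) (R := K)).comp
        (powerSeriesUnion K).val.toRingHom) := by
  apply le_antisymm
  · rw [Ideal.span_le]
    rintro x ⟨i, hi⟩
    change MvPowerSeries.constantCoeff (x : MvPowerSeries ℕ K) = 0
    rw [hi, MvPowerSeries.constantCoeff_X]
  · intro f hf
    obtain ⟨n, hn⟩ := f.2
    exact mem_span_X_of_constantCoeff_eq_zero f hn hf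

end PowerSeries

/-! ### The trivial extension and its ideal `Z` -/

section ResidueExtension

variable {A : Type u} [CommRing A] {m : Ideal A} {ι : Type v}

namespace ResidueExtension

/-- The projection of the trivial extension onto its base ring. -/
noncomputable def fstHom (A : Type u) [CommRing A] (m : Ideal A) (ι : Type v) :
    ResidueExtension A m ι →+* A :=
  (TrivSqZeroExt.fstHom A A (ι →₀ A ⧸ m)).toRingHom

/-- The projection of the trivial extension onto the direct sum of copies of `A ⧸ m`. -/
noncomputable def sndHom (A : Type u) [CommRing A] (m : Ideal A) (ι : Type v) :
    ResidueExtension A m ι →+ (ι →₀ A ⧸ m) :=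
  (TrivSqZeroExt.sndHom A (ι →₀ A ⧸ m)).toAddMonoidHom

theorem ext {x y : ResidueExtension A m ι} (h1 : fstHom A m ι x = fstHom A m ι y)
    (h2 : sndHom A m ι x = sndHom A m ι y) : x = y :=
  TrivSqZeroExt.ext h1 h2

theorem sndHom_mul (x y : ResidueExtension A m ι) :
    sndHom A m ι (x * y) =
      fstHom A m ι x • sndHom A m ι y + fstHom A m ι y • sndHom A m ι x := by
  have := TrivSqZeroExt.snd_mul (R := A) (M := ι →₀ A ⧸ m) x y
  rw [op_smul_eq_smul] at this
  exact this

theorem smul_eq_zero {a : A} (ha : a ∈ m) (e : ι →₀ A ⧸ m) : a • e = 0 := by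
  ext i
  obtain ⟨b, hb⟩ := Ideal.Quotient.mk_surjective (e i)
  rw [Finsupp.smul_apply, ← hb, Finsupp.zero_apply, Algebra.smul_def,
    Ideal.Quotient.algebraMap_eq, ← map_mul, Ideal.Quotient.eq_zero_iff_mem]
  exact Ideal.mul_mem_right _ _ ha

instance : IsLocalHom (fstHom A m ι) :=
  ⟨fun _ hx ↦ TrivSqZeroExt.isUnit_iff_isUnit_fst.mpr hx⟩

instance [IsLocalRing A] : IsLocalRing (ResidueExtension A m ι) :=
  RingHom.domain_isLocalRing (fstHom A m ι)

variable (A m ι) in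
/-- The direct sum of copies of `A ⧸ m`, as an ideal of the trivial extension. -/
noncomputable def socle : Ideal (ResidueExtension A m ι) := RingHom.ker (fstHom A m ι)

theorem mul_eq_zero {z x : ResidueExtension A m ι} (hz : z ∈ socle A m ι)
    (hx : fstHom A m ι x ∈ m) : z * x = 0 := by
  have hz' : fstHom A m ι z = 0 := hz
  refine ext ?_ ?_
  · rw [map_mul, hz', zero_mul, map_zero]
  · rw [sndHom_mul, hz', zero_smul, zero_add, smul_eq_zero hx, map_zero]

theorem sndHom_mul_eq_zero {x y : ResidueExtension A m ι} (hx : fstHom A m ι x ∈ m)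
    (hy : fstHom A m ι y ∈ m) : sndHom A m ι (x * y) = 0 := by
  rw [sndHom_mul, smul_eq_zero hx, smul_eq_zero hy, add_zero]

theorem exists_mem_socle_sndHom_eq (e : ι →₀ A ⧸ m) : ∃ z ∈ socle A m ι, sndHom A m ι z = e :=
  ⟨(TrivSqZeroExt.inr e : TrivSqZeroExt A (ι →₀ A ⧸ m)),
    TrivSqZeroExt.fst_inr (M := ι →₀ A ⧸ m) A e, TrivSqZeroExt.snd_inr (M := ι →₀ A ⧸ m) A e⟩

/-- Finitely many elements have only finitely many nonzero coordinates, and the ideal they generate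
vanishes at every other coordinate `i`. -/
theorem not_fg_socle [Infinite ι] (hm : m ≠ ⊤) : ¬ (socle A m ι).FG := by
  classical
  rintro ⟨s, hs⟩
  obtain ⟨i, hi⟩ := Infinite.exists_notMem_finset (s.biUnion fun x ↦ (sndHom A m ι x).support)
  let T : Ideal (ResidueExtension A m ι) :=
    { carrier := {x | x ∈ socle A m ι ∧ sndHom A m ι x i = 0}
      add_mem' := fun hx hy ↦ ⟨add_mem hx.1 hy.1, by
        rw [map_add, Finsupp.add_apply, hx.2, hy.2, add_zero]⟩
      zero_mem' := ⟨zero_mem _, by rw [map_zero, Finsupp.zero_apply]⟩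
      smul_mem' := fun c x hx ↦ ⟨Ideal.mul_mem_left _ c hx.1, by
        have h0 : fstHom A m ι x = 0 := hx.1
        rw [smul_eq_mul, sndHom_mul, h0, zero_smul, add_zero, Finsupp.smul_apply, hx.2,
          smul_zero]⟩ }
  have hle : socle A m ι ≤ T := by
    rw [← hs, Submodule.span_le]
    intro x hx
    refine ⟨hs ▸ Submodule.subset_span hx, ?_⟩
    by_contra h
    exact hi (Finset.mem_biUnion.mpr ⟨x, hx, Finsupp.mem_support_iff.mpr h⟩)
  obtain ⟨z, hz, hzs⟩ := exists_mem_socle_sndHom_eq (Finsupp.single i (1 : A ⧸ m))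
  have h1 := (hle hz).2
  rw [hzs] at h1
  rw [Finsupp.single_eq_same] at h1
  have : Nontrivial (A ⧸ m) := Ideal.Quotient.nontrivial_iff.mpr hm
  exact one_ne_zero h1

section IsLocalRing

variable [IsLocalRing A]

theorem fstHom_mem_of_mem_maximalIdeal (hm : m.IsMaximal) {x : ResidueExtension A m ι}
    (hx : x ∈ maximalIdeal (ResidueExtension A m ι)) : fstHom A m ι x ∈ m := by
  rw [← maximalIdeal_comap (fstHom A m ι)] at hx
  exact (eq_maximalIdeal hm).ge hx

theorem socle_le_maximalIdeal : socle A m ι ≤ maximalIdeal (ResidueExtension A m ι) :=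
  le_maximalIdeal (RingHom.ker_ne_top _)

theorem socle_mul_maximalIdeal (hm : m.IsMaximal) :
    socle A m ι * maximalIdeal (ResidueExtension A m ι) = ⊥ := by
  rw [eq_bot_iff, Ideal.mul_le]
  intro z hz x hx
  exact mul_eq_zero hz (fstHom_mem_of_mem_maximalIdeal hm hx)

/-- Elements of `Z` have first component zero, while those of `𝔫²` have second component zero
because `m` kills `A/m`. -/
theorem socle_inf_maximalIdeal_sq (hm : m.IsMaximal) :
    socle A m ι ⊓ maximalIdeal (ResidueExtension A m ι) ^ 2 = ⊥ := by
  rw [eq_bot_iff]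
  rintro x ⟨hx, hx2⟩
  refine ext (hx.trans (map_zero _).symm) ?_
  rw [SetLike.mem_coe, pow_two] at hx2
  rw [map_zero]
  exact Submodule.mul_induction_on hx2
    (fun a ha b hb ↦ sndHom_mul_eq_zero (fstHom_mem_of_mem_maximalIdeal hm ha)
      (fstHom_mem_of_mem_maximalIdeal hm hb))
    fun a b ha hb ↦ by rw [map_add, ha, hb, add_zero]

end IsLocalRing

end ResidueExtension

end ResidueExtension

theorem corollary3p2 (K : Type u) [Field K]
    (A : Subalgebra K (MvPowerSeries ℕ K)) (hA : A = powerSeriesUnion K ∨ A = ⊤)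
    (m : Ideal A) (hm : m.IsMaximal) (ι : Type v) [Infinite ι] :
    IsLocalRing A ∧
    (A = powerSeriesUnion K →
      m = Ideal.span {x : A | ∃ i : ℕ, (x : MvPowerSeries ℕ K) = MvPowerSeries.X i}) ∧
    weakGlobalDimension (ResidueExtension A m ι) = ⊤ ∧
    (∀ (M : Type (max u v)) [AddCommGroup M] [Module (ResidueExtension A m ι) M],
      Module.Finite (ResidueExtension A m ι) M →
      IsStronglyGorensteinProjective (ResidueExtension A m ι) M →
      Module.Projective (ResidueExtension A m ι) M) ∧
    (∀ I : Ideal (ResidueExtension A m ι), I.FG → I ≠ ⊥ → I ≠ ⊤ →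
      ¬ IsStronglyGorensteinProjective (ResidueExtension A m ι) I) := by
  have hinv : ∀ f ∈ A, f⁻¹ ∈ A := by
    rcases hA with rfl | rfl
    · exact fun f hf ↦ inv_mem_powerSeriesUnion hf
    · exact fun f _ ↦ Algebra.mem_top
  have hhom := isLocalHom_constantCoeff_comp_val hinv
  have hloc : IsLocalRing A := RingHom.domain_isLocalRing
    ((MvPowerSeries.constantCoeff (σ := ℕ) (R := K)).comp A.val.toRingHom)
  have hfg := ResidueExtension.not_fg_socle (ι := ι) hm.ne_top
  have hmul := ResidueExtension.socle_mul_maximalIdeal (ι := ι) hm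
  have hsq := ResidueExtension.socle_inf_maximalIdeal_sq (ι := ι) hm
  refine ⟨hloc, ?_, ?_, fun M _ _ _ hM ↦ hM.projective hfg hmul hsq,
    fun I ↦ Ideal.not_isStronglyGorensteinProjective hfg hmul hsq⟩
  -- Both ideals are the kernel of the constant coefficient.
  · rintro rfl
    rw [span_X_eq_ker_constantCoeff, IsLocalRing.eq_maximalIdeal hm]
    rw [← maximalIdeal_comap ((MvPowerSeries.constantCoeff (σ := ℕ) (R := K)).comp
      (powerSeriesUnion K).val.toRingHom), isField_iff_maximalIdeal_eq.mp (Field.toIsField K)]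
    rfl
  · obtain ⟨z, hz, hz0⟩ := Submodule.exists_mem_ne_zero_of_ne_bot
      (p := ResidueExtension.socle A m ι) (fun h ↦ hfg (h ▸ Submodule.fg_bot))
    refine weakGlobalDimension_eq_top (ResidueExtension.socle_le_maximalIdeal hz)
      (fun h ↦ hz0 ?_) fun x hx ↦ ?_
    · have : z ∈ (⊥ : Ideal _) := hsq ▸ ⟨hz, h⟩
      exact this
    · rw [mul_comm]
      exact ResidueExtension.mul_eq_zero hz
        (ResidueExtension.fstHom_mem_of_mem_maximalIdeal hm hx)
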